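/- Let $d\ge 1$ and $\Lambda>1$. Write $C(\mathbb T^d;[1,\Lambda])$ for the continuous $\mathbb Z^d$-periodic functions $\mathbb R^d\to[1,\Lambda]$ (media). For a $C^2$ open set $\Omega\subset\mathbb R^d$ let $n$ be the outward unit normal of $\partial\Omega$ and $\kappa$ its mean curvature (the sum of the principal curvatures, nonnegative if $\Omega$ is convex). For a medium $b$ of class $C^2$, call $\chi_{\overline\Omega}$ (the indicator function of $\overline\Omega$, equal to $1$ on $\overline\Omega$ and $0$ elsewhere) a strict stationary subsolution of $V_n=-b\,\kappa-\nabla b\cdot n$ if $$-b(\xi)\,\kappa(\xi)-\nabla b(\xi)\cdot n(\xi)>0\qquad\text{for every }\xi\in\partial\Omega,$$ and, in level set form, if $$-b(x)\,\mathrm{tr}\Big(\big(\mathrm{Id}-\tfrac{D\varphi(x)}{|D\varphi(x)|}\otimes\tfrac{D\varphi(x)}{|D\varphi(x)|}\big)D^2\varphi(x)\Big)-Db(x)\cdot D\varphi(x)<0$$ whenever $\varphi$ is $C^2$ near $x$, $\chi_{\overline\Omega}-\varphi$ has a local maximum at $x$ and $D\varphi(x)\neq0$. (For a bounded $C^2$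 open set the two conditions are equivalent.) Let $a\in C(\mathbb T^d;[1,\Lambda])$ and $\delta>0$. Then there are a medium $a_\delta\in C(\mathbb T^d;[1,\Lambda])$ of class $C^2$ with $\|a-a_\delta\|_{C(\mathbb T^d)}\le\delta$, and a bounded open set $\Omega\subset\mathbb R^d$ of class $C^2$, with $\emptyset\ne\Omega\ne\mathbb R^d$, such that $\chi_{\overline\Omega}$ is a strict stationary subsolution of $V_n=-a_\delta\kappa-\nabla a_\delta\cdot n$. If, in addition, $a$ is of class $C^2$ and $p\in[1,\infty)$, then $a_\delta$ and $\Omega$ can be chosen such that moreover $\|a-a_\delta\|_{W^{1,p}(\mathbb T^d)}\le\delta$, where $\|f\|_{W^{1,p}(\mathbb T^d)}=\|f\|_{L^p(\mathbb T^d)}+\|\nabla f\|_{L^p(\mathbb T^d)}$. -/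

import Mathlib

open Set MeasureTheory
open scoped Topology Gradient InnerProductSpace

/-- `C(𝕋^d; [1, Λ])`: continuous, `ℤ^d`-periodic functions on `ℝ^d` with values in `[1, Λ]`. -/
structure IsMedium {d : ℕ} (Λ : ℝ) (a : EuclideanSpace ℝ (Fin d) → ℝ) : Prop where
  continuous : Continuous a
  periodic : ∀ (k : Fin d → ℤ) (x : EuclideanSpace ℝ (Fin d)),
    a (x + WithLp.toLp 2 (fun i => (k i : ℝ))) = a x
  mem_Icc : ∀ x, a x ∈ Icc 1 Λ

/-- The fundamental cell `[0, 1)^d` of the torus `𝕋^d = ℝ^d / ℤ^d`. -/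
def unitCell (d : ℕ) : Set (EuclideanSpace ℝ (Fin d)) :=
  {x | ∀ i, x i ∈ Ico (0 : ℝ) 1}

/-- The norm `‖f‖_{L^p(𝕋^d)} + ‖Df‖_{L^p(𝕋^d)}` of `W^{1,p}(𝕋^d)`, for periodic `f` of class `C¹`
(so that the weak gradient is the classical one), with values in `[0, ∞]`. -/
noncomputable def torusSobolevNorm {d : ℕ} (p : ℝ) (f : EuclideanSpace ℝ (Fin d) → ℝ) : ENNReal :=
  eLpNorm f (ENNReal.ofReal p) (volume.restrict (unitCell d)) +
    eLpNorm (fun x => ∇ f x) (ENNReal.ofReal p) (volume.restrict (unitCell d))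

/-- Open sets of class `C²`: near each boundary point, `Ω` is the set where some `C²` function with
nonvanishing gradient is positive. -/
def IsC2OpenSet {d : ℕ} (Ω : Set (EuclideanSpace ℝ (Fin d))) : Prop :=
  IsOpen Ω ∧ ∀ ξ ∈ frontier Ω, ∃ g : EuclideanSpace ℝ (Fin d) → ℝ,
    ContDiffAt ℝ 2 g ξ ∧ ∇ g ξ ≠ 0 ∧ ∀ᶠ x in 𝓝 ξ, x ∈ Ω ↔ 0 < g x

/-- The signed distance to `∂Ω`, positive in `Ω` and negative outside `closure Ω`. -/
noncomputable def signedDistance {d : ℕ} (Ω : Set (EuclideanSpace ℝ (Fin d)))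
    (x : EuclideanSpace ℝ (Fin d)) : ℝ :=
  Metric.infDist x Ωᶜ - Metric.infDist x Ω

/-- The outward unit normal `n = -D d_Ω` on `∂Ω`. -/
noncomputable def outwardNormal {d : ℕ} (Ω : Set (EuclideanSpace ℝ (Fin d)))
    (ξ : EuclideanSpace ℝ (Fin d)) : EuclideanSpace ℝ (Fin d) :=
  -∇ (signedDistance Ω) ξ

/-- The mean curvature `κ = -tr (D² d_Ω)` of `∂Ω`: the sum of the principal curvatures, nonnegative
for convex `Ω`. -/
noncomputable def meanCurvature {d : ℕ} (Ω : Set (EuclideanSpace ℝ (Fin d)))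
    (ξ : EuclideanSpace ℝ (Fin d)) : ℝ :=
  -(Laplacian.laplacian (signedDistance Ω) ξ)

/-- `Ω` satisfies `0 < -a κ - ∇a · n` on `∂Ω` in the classical sense: it is a strict stationary
subsolution of `V_n = -a κ - ∇a · n`. The regularity of the signed distance at `∂Ω`, without which
`κ` and `n` would have no meaning, is part of the definition. -/
def IsClassicalStrictSubsolution {d : ℕ} (a : EuclideanSpace ℝ (Fin d) → ℝ)
    (Ω : Set (EuclideanSpace ℝ (Fin d))) : Prop :=
  ∀ ξ ∈ frontier Ω, ContDiffAt ℝ 2 (signedDistance Ω) ξ ∧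
    0 < -(a ξ) * meanCurvature Ω ξ - inner ℝ (∇ a ξ) (outwardNormal Ω ξ)

/-- The level set operator
`-a(x) tr ((Id - Dφ̂ ⊗ Dφ̂) D²φ) - Da(x) · Dφ`, where `Dφ̂ = Dφ / |Dφ|`, for `Dφ(x) ≠ 0`. -/
noncomputable def levelSetOperator {d : ℕ} (a φ : EuclideanSpace ℝ (Fin d) → ℝ)
    (x : EuclideanSpace ℝ (Fin d)) : ℝ :=
  -(a x) * (Laplacian.laplacian φ x
      - iteratedFDeriv ℝ 2 φ x (fun _ => (‖∇ φ x‖)⁻¹ • ∇ φ x))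
    - inner ℝ (∇ a x) (∇ φ x)

/-- `u` is a strict stationary subsolution, in the viscosity sense, of the level set form
`-a tr ((Id - Dû ⊗ Dû) D²u) - Da · Du = 0` of `V_n = -a κ - ∇a · n`: it is upper semicontinuous, and
the strict inequality holds for every `C²` test function that touches `u` from above with nonzero
gradient. -/
def IsViscosityStrictSubsolution {d : ℕ} (a u : EuclideanSpace ℝ (Fin d) → ℝ) : Prop :=
  UpperSemicontinuous u ∧
  ∀ (φ : EuclideanSpace ℝ (Fin d) → ℝ) (x : EuclideanSpace ℝ (Fin d)),
    ContDiffAt ℝ 2 φ x → IsLocalMax (fun y => u y - φ y) x → ∇ φ x ≠ 0 →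
      levelSetOperator a φ x < 0

/-- `a` is of class `C²`, and `Ω` is a bounded nontrivial open set of class `C²` which is a strict
stationary subsolution of `V_n = -a κ - ∇a · n`: classically, and, through the indicator function
of its closure, in the viscosity sense. -/
structure IsStrictBarrier {d : ℕ} (a : EuclideanSpace ℝ (Fin d) → ℝ)
    (Ω : Set (EuclideanSpace ℝ (Fin d))) : Prop where
  contDiff : ContDiff ℝ 2 a
  isC2OpenSet : IsC2OpenSet Ω
  isBounded : Bornology.IsBounded Ω
  nonempty : Ω.Nonempty
  ne_univ : Ω ≠ univ
  classical : IsClassicalStrictSubsolution a Ω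
  viscosity : IsViscosityStrictSubsolution a (indicator (closure Ω) (fun _ => (1 : ℝ)))

/-! The barrier is the ball of radius `1/4` about the centre of the unit cell. For a ball of radius
`R` both notions of strict subsolution follow from one inequality on the sphere, `a (d - 1) / R +
∂ₙa < 0` (`isStrictBarrier_ball`), so the medium only has to decrease steeply enough across the
sphere.

Uniform closeness does not restrict slopes. Adding `M h θ((|y - c|² - R²) / h)`, periodized, creates
slope `-M/2` on the sphere, while its size is `O(h)` and its gradient is bounded independently of
`h` and lives on a shell whose measure vanishes as `h → 0`. It is therefore small in the uniform
norm and in `W^{1,p}` for finite `p`. Contracting `a` slightly towards the midpoint of `[1, Λ]`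
first leaves room for the perturbation (`IsMedium.exists_strictBarrier`). A merely continuous medium
is mollified beforehand.

The geometric core is `tangential_laplacian_ge`: a function with a local minimum on the sphere
satisfies second-order inequalities along great circles. It is applied to the signed distance, which
is constant on the sphere, and to viscosity test functions. -/

theorem deriv_deriv_nonneg_of_isLocalMin {g : ℝ → ℝ} {s : ℝ} (hg : ContinuousAt g s)
    (h : IsLocalMin g s) : 0 ≤ deriv (deriv g) s := by
  by_contra! hneg
  -- A negative second derivative would make the point a local maximum too, so `g` would be locally
  -- constant.
  have hmax := isLocalMax_of_deriv_deriv_neg hneg h.deriv_eq_zero hg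
  have hc : g =ᶠ[𝓝 s] fun _ => g s := by
    filter_upwards [h, hmax] with y h1 h2 using le_antisymm h2 h1
  have h2 : deriv g =ᶠ[𝓝 s] deriv fun _ => g s := hc.deriv
  rw [h2.deriv_eq] at hneg
  simp at hneg

/-! ### Second-order conditions along great circles -/

section Curves

variable {E : Type*} [NormedAddCommGroup E] [InnerProductSpace ℝ E]

theorem iteratedFDeriv_two_diag (f : E → ℝ) (x v : E) :
    iteratedFDeriv ℝ 2 f x (fun _ => v) = fderiv ℝ (fderiv ℝ f) x v v := by
  rw [iteratedFDeriv_two_apply]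

theorem deriv_deriv_comp_curve {φ : E → ℝ} {γ γ' : ℝ → E} {γ'' : E} {s : ℝ}
    (hφ : ContDiffAt ℝ 2 φ (γ s)) (hγ : ∀ t, HasDerivAt γ (γ' t) t) (hγ' : HasDerivAt γ' γ'' s) :
    deriv (deriv fun t => φ (γ t)) s
      = fderiv ℝ (fderiv ℝ φ) (γ s) (γ' s) (γ' s) + fderiv ℝ φ (γ s) γ'' := by
  have h1 : ∀ᶠ y in 𝓝 (γ s), DifferentiableAt ℝ φ y :=
    (hφ.eventually (by simp)).mono fun y hy => hy.differentiableAt (by simp)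
  have h2 : (deriv fun t => φ (γ t)) =ᶠ[𝓝 s] fun t => fderiv ℝ φ (γ t) (γ' t) := by
    filter_upwards [(hγ s).continuousAt.eventually h1] with t ht
    exact (ht.hasFDerivAt.comp_hasDerivAt t (hγ t)).deriv
  rw [h2.deriv_eq]
  have h3 : HasFDerivAt (fderiv ℝ φ) (fderiv ℝ (fderiv ℝ φ) (γ s)) (γ s) :=
    ((hφ.fderiv_right (m := 1) (by norm_num)).differentiableAt (by simp)).hasFDerivAt
  exact ((h3.comp_hasDerivAt s (hγ s)).clm_apply hγ').deriv

theorem norm_cos_smul_add_sin_smul {n τ : E} (hn : ‖n‖ = 1) (hτ : ‖τ‖ = 1) (h : inner ℝ n τ = 0)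
    (s : ℝ) : ‖Real.cos s • n + Real.sin s • τ‖ = 1 := by
  have h1 : ‖Real.cos s • n + Real.sin s • τ‖ ^ 2 = 1 := by
    rw [norm_add_sq_real, norm_smul, norm_smul, inner_smul_left, inner_smul_right, h, hn, hτ]
    simp
  nlinarith [norm_nonneg (Real.cos s • n + Real.sin s • τ)]

variable {φ : E → ℝ} {c n τ : E} {R : ℝ}

/-- First and second order conditions along a great circle at a minimum on the sphere. -/
theorem great_circle_conditions (hR : 0 < R) (hn : ‖n‖ = 1) (hτ : ‖τ‖ = 1) (h : inner ℝ n τ = 0)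
    (hφ : ContDiffAt ℝ 2 φ (c + R • n))
    (hmin : IsLocalMinOn φ (Metric.sphere c R) (c + R • n)) :
    fderiv ℝ φ (c + R • n) τ = 0 ∧
      fderiv ℝ φ (c + R • n) n / R ≤ fderiv ℝ (fderiv ℝ φ) (c + R • n) τ τ := by
  -- Here `γ' = R τ` and `γ'' = -R n` at `0`, so the second derivative of `φ ∘ γ` is `R² D²φ(τ, τ) -
  -- R ∂ₙφ`; the acceleration produces the curvature term.
  set γ : ℝ → E := fun s => c + R • (Real.cos s • n + Real.sin s • τ) with hγdef
  have hγ0 : γ 0 = c + R • n := by simp [hγdef]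
  have hγ : ∀ s, HasDerivAt γ (R • ((-Real.sin s) • n + Real.cos s • τ)) s := fun s =>
    ((((Real.hasDerivAt_cos s).smul_const n).add
      ((Real.hasDerivAt_sin s).smul_const τ)).const_smul R).const_add c
  have hγ' : HasDerivAt (fun s => R • ((-Real.sin s) • n + Real.cos s • τ)) (-(R • n)) 0 := by
    have := ((((Real.hasDerivAt_sin 0).neg.smul_const n).add
      ((Real.hasDerivAt_cos 0).smul_const τ)).const_smul R)
    rw [Real.cos_zero, Real.sin_zero, neg_zero, zero_smul, add_zero, neg_one_smul, smul_neg] at this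
    exact this
  have hmem : ∀ s, γ s ∈ Metric.sphere c R := fun s => by
    rw [mem_sphere_iff_norm, hγdef, add_sub_cancel_left, norm_smul,
      norm_cos_smul_add_sin_smul hn hτ h, Real.norm_of_nonneg hR.le, mul_one]
  have hcont : ContinuousAt γ 0 := (hγ 0).continuousAt
  have hg : IsLocalMin (fun s => φ (γ s)) 0 := by
    have ht : Filter.Tendsto γ (𝓝 0) (𝓝[Metric.sphere c R] (c + R • n)) := by
      rw [← hγ0]
      exact tendsto_nhdsWithin_iff.2 ⟨hcont, Filter.Eventually.of_forall hmem⟩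
    have := ht.eventually hmin
    simpa [IsLocalMin, IsMinFilter, hγ0] using this
  rw [← hγ0] at hφ ⊢
  have hd : HasFDerivAt φ (fderiv ℝ φ (γ 0)) (γ 0) :=
    (hφ.differentiableAt (by simp)).hasFDerivAt
  constructor
  · have h1 := hg.hasDerivAt_eq_zero (hd.comp_hasDerivAt 0 (hγ 0))
    simpa [hR.ne'] using h1
  · have h2 : 0 ≤ deriv (deriv fun s => φ (γ s)) 0 :=
      deriv_deriv_nonneg_of_isLocalMin (hφ.continuousAt.comp (f := γ) hcont) hg
    rw [deriv_deriv_comp_curve hφ hγ hγ'] at h2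
    simp only [Real.sin_zero, neg_zero, zero_smul, Real.cos_zero, one_smul, zero_add, map_smul,
      map_neg, smul_apply, smul_eq_mul] at h2
    rw [div_le_iff₀ hR]
    have h3 : 0 ≤ R * (R * fderiv ℝ (fderiv ℝ φ) (γ 0) τ τ - fderiv ℝ φ (γ 0) n) := by linarith
    have := nonneg_of_mul_nonneg_right h3 hR
    linarith

end Curves

/-! ### Minima on a sphere in Euclidean space -/

section Sphere

variable {d : ℕ} {φ : EuclideanSpace ℝ (Fin d) → ℝ} {c n : EuclideanSpace ℝ (Fin d)} {R : ℝ}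

/-- If the tangential part `w` of the gradient were nonzero, the first-order condition in the
direction of `w` itself would force `|w|² = 0`. -/
theorem gradient_eq_smul_of_isLocalMinOn_sphere (hR : 0 < R) (hn : ‖n‖ = 1)
    (hφ : ContDiffAt ℝ 2 φ (c + R • n))
    (hmin : IsLocalMinOn φ (Metric.sphere c R) (c + R • n)) :
    ∇ φ (c + R • n) = fderiv ℝ φ (c + R • n) n • n := by
  set x := c + R • n
  set w := ∇ φ x - fderiv ℝ φ x n • n with hw
  have hwn : inner ℝ n w = 0 := by
    rw [hw, inner_sub_right, inner_smul_right, real_inner_self_eq_norm_sq, hn,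
      real_inner_comm, inner_gradient_left]
    simp
  have hw0 : w = 0 := by
    by_contra hne
    have hpos : 0 < ‖w‖ := norm_pos_iff.2 hne
    have h1 := (great_circle_conditions (τ := ‖w‖⁻¹ • w) hR hn
      (by rw [norm_smul, norm_inv, norm_norm, inv_mul_cancel₀ hpos.ne'])
      (by rw [inner_smul_right, hwn, mul_zero]) hφ hmin).1
    rw [map_smul, smul_eq_mul, ← inner_gradient_left] at h1
    have h2 : inner ℝ (∇ φ x) w = 0 := by
      rcases mul_eq_zero.1 h1 with h | h
      · exact absurd h (inv_ne_zero hpos.ne')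
      · exact h
    have h3 : inner ℝ w w = 0 := by
      nth_rewrite 1 [hw]
      rw [inner_sub_left, inner_smul_left, h2, hwn]
      simp
    exact hne (inner_self_eq_zero.1 h3)
  exact sub_eq_zero.1 hw0

/-- Complete `n` to an orthonormal basis and sum the great circle inequality over the `d - 1`
tangential vectors. -/
theorem tangential_laplacian_ge (hd : 1 ≤ d) (hR : 0 < R) (hn : ‖n‖ = 1)
    (hφ : ContDiffAt ℝ 2 φ (c + R • n))
    (hmin : IsLocalMinOn φ (Metric.sphere c R) (c + R • n)) :
    (d - 1) * (fderiv ℝ φ (c + R • n) n / R) ≤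
      Laplacian.laplacian φ (c + R • n) - fderiv ℝ (fderiv ℝ φ) (c + R • n) n n := by
  set x := c + R • n
  let i₀ : Fin d := ⟨0, hd⟩
  obtain ⟨b, hb⟩ := Orthonormal.exists_orthonormalBasis_extension_of_card_eq (𝕜 := ℝ)
    (E := EuclideanSpace ℝ (Fin d)) (ι := Fin d) (by simp) (v := fun _ => n) (s := {i₀})
    (by
      rw [orthonormal_iff_ite]
      rintro ⟨i, hi⟩ ⟨j, hj⟩
      obtain rfl : i = i₀ := hi
      obtain rfl : j = i₀ := hj
      simp [Set.domRestrict, hn])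
  have hb0 : b i₀ = n := hb i₀ rfl
  have hlap : Laplacian.laplacian φ x = ∑ i, fderiv ℝ (fderiv ℝ φ) x (b i) (b i) := by
    have := congrFun (InnerProductSpace.laplacian_eq_iteratedFDeriv_orthonormalBasis φ b) x
    rw [this]
    exact Finset.sum_congr rfl fun i _ => by rw [iteratedFDeriv_two_apply]; rfl
  rw [hlap, ← Finset.add_sum_erase _ _ (Finset.mem_univ i₀), hb0, add_sub_cancel_left]
  have hcard : ((Finset.univ.erase i₀).card : ℝ) = d - 1 := by
    rw [Finset.card_erase_of_mem (Finset.mem_univ _), Finset.card_univ, Fintype.card_fin,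
      Nat.cast_sub hd, Nat.cast_one]
  rw [← hcard, ← nsmul_eq_mul]
  refine Finset.card_nsmul_le_sum _ _ _ fun i hi => ?_
  refine (great_circle_conditions hR hn (b.norm_eq_one i) ?_ hφ hmin).2
  rw [← hb0]
  exact b.inner_eq_zero (Finset.ne_of_mem_erase hi).symm

end Sphere

/-! ### Balls as strict barriers -/

section Ball

variable {d : ℕ} {c : EuclideanSpace ℝ (Fin d)} {R : ℝ}

theorem exists_unit_direction {x : EuclideanSpace ℝ (Fin d)} (hx : x ≠ c) :
    ∃ n : EuclideanSpace ℝ (Fin d), ‖n‖ = 1 ∧ x = c + ‖x - c‖ • n := by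
  have hpos : 0 < ‖x - c‖ := norm_pos_iff.2 (sub_ne_zero.2 hx)
  refine ⟨‖x - c‖⁻¹ • (x - c), ?_, ?_⟩
  · rw [norm_smul, norm_inv, norm_norm, inv_mul_cancel₀ hpos.ne']
  · rw [smul_smul, mul_inv_cancel₀ hpos.ne', one_smul, add_sub_cancel]

/-- Away from the centre there is a radial direction, and the radial projection onto the sphere
realizes the distance; its existence also makes the complement nonempty. -/
theorem infDist_compl_ball_of_ne (hR : 0 < R) {x : EuclideanSpace ℝ (Fin d)} (hx : x ≠ c) :
    Metric.infDist x (Metric.ball c R)ᶜ = max (R - ‖x - c‖) 0 := by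
  obtain ⟨n, hn, hxn⟩ := exists_unit_direction hx
  have hmem : c + R • n ∈ (Metric.ball c R)ᶜ := by
    simp [norm_smul, hn, abs_of_pos hR]
  rcases le_total R ‖x - c‖ with h | h
  · rw [max_eq_right (by linarith), Metric.infDist_zero_of_mem]
    simpa [dist_eq_norm] using h
  · rw [max_eq_left (by linarith)]
    apply le_antisymm
    · refine (Metric.infDist_le_dist_of_mem hmem).trans ?_
      nth_rewrite 1 [hxn]
      rw [dist_add_left, dist_eq_norm, ← sub_smul, norm_smul, hn, mul_one, norm_sub_rev,
        Real.norm_of_nonneg (by linarith)]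
    · refine (Metric.le_infDist ⟨_, hmem⟩).2 fun y hy => ?_
      have hy' : R ≤ dist y c := by simpa using hy
      have := dist_triangle y x c
      rw [dist_comm y x, dist_eq_norm x c] at this
      linarith

theorem infDist_ball_of_ne (hR : 0 < R) {x : EuclideanSpace ℝ (Fin d)} (hx : x ≠ c) :
    Metric.infDist x (Metric.ball c R) = max (‖x - c‖ - R) 0 := by
  obtain ⟨n, hn, hxn⟩ := exists_unit_direction hx
  rw [← Metric.infDist_closure, closure_ball c hR.ne']
  have hmem : c + R • n ∈ Metric.closedBall c R := by
    simp [norm_smul, hn, abs_of_pos hR]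
  rcases le_total ‖x - c‖ R with h | h
  · rw [max_eq_right (by linarith), Metric.infDist_zero_of_mem]
    simpa [dist_eq_norm] using h
  · rw [max_eq_left (by linarith)]
    apply le_antisymm
    · refine (Metric.infDist_le_dist_of_mem hmem).trans ?_
      nth_rewrite 1 [hxn]
      rw [dist_add_left, dist_eq_norm, ← sub_smul, norm_smul, hn, mul_one,
        Real.norm_of_nonneg (by linarith)]
    · refine (Metric.le_infDist ⟨_, hmem⟩).2 fun y hy => ?_
      have hy' : dist y c ≤ R := by simpa using hy
      have := dist_triangle x y c
      rw [dist_eq_norm x c] at this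
      linarith

theorem signedDistance_ball_of_ne (hR : 0 < R) {x : EuclideanSpace ℝ (Fin d)} (hx : x ≠ c) :
    signedDistance (Metric.ball c R) x = R - ‖x - c‖ := by
  rw [signedDistance, infDist_compl_ball_of_ne hR hx, infDist_ball_of_ne hR hx]
  rcases le_total ‖x - c‖ R with h | h
  · rw [max_eq_left (by linarith), max_eq_right (by linarith), sub_zero]
  · rw [max_eq_right (by linarith), max_eq_left (by linarith)]; ring

theorem signedDistance_ball_eventuallyEq (hR : 0 < R) {x : EuclideanSpace ℝ (Fin d)}
    (hx : x ≠ c) : signedDistance (Metric.ball c R) =ᶠ[𝓝 x] fun y => R - ‖y - c‖ := by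
  filter_upwards [isOpen_ne.mem_nhds hx] with y hy using signedDistance_ball_of_ne hR hy

theorem contDiffAt_signedDistance_ball (hR : 0 < R) {x : EuclideanSpace ℝ (Fin d)} (hx : x ≠ c) :
    ContDiffAt ℝ 2 (signedDistance (Metric.ball c R)) x := by
  refine ContDiffAt.congr_of_eventuallyEq ?_ (signedDistance_ball_eventuallyEq hR hx)
  exact contDiffAt_const.sub ((contDiffAt_id.sub contDiffAt_const).norm ℝ (sub_ne_zero.2 hx))

theorem isLocalMinOn_signedDistance_ball (hR : 0 < R) {x : EuclideanSpace ℝ (Fin d)}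
    (hx : x ∈ Metric.sphere c R) :
    IsLocalMinOn (signedDistance (Metric.ball c R)) (Metric.sphere c R) x := by
  have h0 : ∀ y ∈ Metric.sphere c R, signedDistance (Metric.ball c R) y = 0 := fun y hy => by
    rw [signedDistance_ball_of_ne hR (Metric.ne_of_mem_sphere hy hR.ne'),
      mem_sphere_iff_norm.1 hy, sub_self]
  filter_upwards [self_mem_nhdsWithin] with y hy
  rw [h0 x hx, h0 y hy]

/-- On the ray `t ↦ c + t n` the signed distance is the affine function `R - t`. -/
theorem fderiv_signedDistance_ball (hR : 0 < R) {n : EuclideanSpace ℝ (Fin d)} (hn : ‖n‖ = 1) :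
    fderiv ℝ (signedDistance (Metric.ball c R)) (c + R • n) n = -1 ∧
    fderiv ℝ (fderiv ℝ (signedDistance (Metric.ball c R))) (c + R • n) n n = 0 := by
  have hne : ∀ t : ℝ, 0 < t → c + t • n ≠ c := fun t ht h => by
    have : t • n = 0 := by simpa using h
    have h2 : ‖t • n‖ = t := by rw [norm_smul, hn, mul_one, Real.norm_of_nonneg ht.le]
    rw [this, norm_zero] at h2
    linarith
  have hγ : ∀ t : ℝ, HasDerivAt (fun t : ℝ => c + t • n) n t := fun t => by
    simpa using ((hasDerivAt_id t).smul_const n).const_add c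
  have hline : (fun t : ℝ => signedDistance (Metric.ball c R) (c + t • n)) =ᶠ[𝓝 R]
      fun t => R - t := by
    filter_upwards [lt_mem_nhds hR] with t ht
    rw [signedDistance_ball_of_ne hR (hne t ht), add_sub_cancel_left, norm_smul, hn, mul_one,
      Real.norm_of_nonneg ht.le]
  have hlin : deriv (fun t : ℝ => R - t) = fun _ => -1 := by
    ext t; simp
  have hC := contDiffAt_signedDistance_ball hR (hne R hR)
  constructor
  · have h1 := (hC.differentiableAt (by simp)).hasFDerivAt.comp_hasDerivAt R (hγ R)
    rw [← h1.deriv]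
    exact hline.deriv_eq.trans (by rw [hlin])
  · have h2 := deriv_deriv_comp_curve (γ := fun t : ℝ => c + t • n) (γ' := fun _ => n) hC hγ
      (hasDerivAt_const R n)
    rw [map_zero, add_zero] at h2
    rw [← h2, hline.deriv.deriv_eq, hlin, deriv_const]

theorem isC2OpenSet_ball (hR : 0 < R) : IsC2OpenSet (Metric.ball c R) := by
  refine ⟨Metric.isOpen_ball, fun ξ hξ => ⟨fun x => R ^ 2 - ‖x - c‖ ^ 2, ?_, ?_, ?_⟩⟩
  · exact contDiffAt_const.sub ((contDiffAt_id.sub contDiffAt_const).norm_sq ℝ)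
  · rw [frontier_ball c hR.ne', mem_sphere_iff_norm] at hξ
    intro h0
    have h1 : HasFDerivAt (fun x => R ^ 2 - ‖x - c‖ ^ 2)
        (-(2 • (innerSL ℝ (ξ - c)).comp (ContinuousLinearMap.id ℝ _))) ξ :=
      (((hasFDerivAt_id ξ).sub_const c).norm_sq).const_sub (R ^ 2)
    have h2 : inner ℝ (∇ (fun x => R ^ 2 - ‖x - c‖ ^ 2) ξ) (ξ - c) = -(2 * R ^ 2) := by
      rw [inner_gradient_left, h1.fderiv]
      rw [ContinuousLinearMap.comp_id, neg_apply, smul_apply, innerSL_apply_apply,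
        real_inner_self_eq_norm_sq, hξ, nsmul_eq_mul, Nat.cast_ofNat]
    rw [h0, inner_zero_left] at h2
    nlinarith
  · refine Filter.Eventually.of_forall fun x => ?_
    rw [mem_ball_iff_norm, sub_pos, sq_lt_sq₀ (norm_nonneg _) hR.le]

/-- Since `a > 0`, only the bound `κ ≤ (d - 1) / R` is needed, and it comes from the tangential
inequality for the signed distance, whose normal derivative is `-1`. -/
theorem isClassicalStrictSubsolution_ball (hd : 1 ≤ d) (hR : 0 < R)
    {a : EuclideanSpace ℝ (Fin d) → ℝ} (hpos : ∀ x, 0 < a x)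
    (hslope : ∀ n : EuclideanSpace ℝ (Fin d), ‖n‖ = 1 →
      a (c + R • n) * ((d - 1) / R) + inner ℝ (∇ a (c + R • n)) n < 0) :
    IsClassicalStrictSubsolution a (Metric.ball c R) := by
  intro ξ hξ
  rw [frontier_ball c hR.ne'] at hξ
  have hne : ξ ≠ c := Metric.ne_of_mem_sphere hξ hR.ne'
  refine ⟨contDiffAt_signedDistance_ball hR hne, ?_⟩
  obtain ⟨n, hn, hξn⟩ := exists_unit_direction hne
  rw [mem_sphere_iff_norm.1 hξ] at hξn
  subst hξn
  have hC := contDiffAt_signedDistance_ball hR hne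
  have hmin := isLocalMinOn_signedDistance_ball hR hξ
  obtain ⟨h1, h2⟩ := fderiv_signedDistance_ball (c := c) hR hn
  have hlap := tangential_laplacian_ge hd hR hn hC hmin
  have hgrad := gradient_eq_smul_of_isLocalMinOn_sphere hR hn hC hmin
  rw [h1, h2, sub_zero] at hlap
  rw [h1, neg_one_smul] at hgrad
  rw [meanCurvature, outwardNormal, hgrad, neg_neg]
  have h3 := mul_le_mul_of_nonneg_left hlap (hpos (c + R • n)).le
  have h4 : a (c + R • n) * ((d - 1) * (-1 / R)) = -(a (c + R • n) * ((d - 1) / R)) := by ring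
  linarith [hslope n hn]

theorem isLocalMinOn_of_isLocalMax_indicator_sub {φ : EuclideanSpace ℝ (Fin d) → ℝ}
    {x : EuclideanSpace ℝ (Fin d)} {K : Set (EuclideanSpace ℝ (Fin d))} (hx : x ∈ K)
    (h : IsLocalMax (fun y => indicator K (fun _ => (1 : ℝ)) y - φ y) x) : IsLocalMinOn φ K x := by
  filter_upwards [h.filter_mono nhdsWithin_le_nhds, self_mem_nhdsWithin] with y hy hyK
  simp only [indicator_of_mem hx, indicator_of_mem hyK] at hy
  linarith

/-- Off the sphere the indicator is locally constant, so a touching test function has zero gradient.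
On the sphere the test function has gradient `μ n` with `μ < 0`, and its tangential Laplacian is at
least `(d - 1) μ / R`. The operator is then at most `-μ` times the negative quantity in `hslope`. -/
theorem isViscosityStrictSubsolution_ball (hd : 1 ≤ d) (hR : 0 < R)
    {a : EuclideanSpace ℝ (Fin d) → ℝ} (hpos : ∀ x, 0 < a x)
    (hslope : ∀ n : EuclideanSpace ℝ (Fin d), ‖n‖ = 1 →
      a (c + R • n) * ((d - 1) / R) + inner ℝ (∇ a (c + R • n)) n < 0) :
    IsViscosityStrictSubsolution a (indicator (closure (Metric.ball c R)) (fun _ => (1 : ℝ))) := by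
  rw [closure_ball c hR.ne']
  refine ⟨Metric.isClosed_closedBall.upperSemicontinuous_indicator zero_le_one,
    fun φ x hφ hmax hgrad => ?_⟩
  have hflat : ¬ IsLocalMin φ x := fun h => hgrad <| by
    rw [gradient, h.fderiv_eq_zero, map_zero]
  have hmem : x ∈ Metric.closedBall c R := by
    by_contra hx
    refine hflat ?_
    filter_upwards [hmax, Metric.isClosed_closedBall.isOpen_compl.mem_nhds hx] with y hy hyK
    simp only [indicator_of_notMem hx, indicator_of_notMem hyK] at hy
    linarith
  have hminK := isLocalMinOn_of_isLocalMax_indicator_sub hmem hmax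
  have hsphere : x ∈ Metric.sphere c R := by
    rw [← Metric.closedBall_sdiff_ball]
    refine ⟨hmem, fun hx => hflat ?_⟩
    exact hminK.isLocalMin (Filter.mem_of_superset (Metric.isOpen_ball.mem_nhds hx)
      Metric.ball_subset_closedBall)
  obtain ⟨n, hn, hxn⟩ := exists_unit_direction (Metric.ne_of_mem_sphere hsphere hR.ne')
  rw [mem_sphere_iff_norm.1 hsphere] at hxn
  subst hxn
  have hmin := hminK.on_subset Metric.sphere_subset_closedBall
  have hlap := tangential_laplacian_ge hd hR hn hφ hmin
  have hgradn := gradient_eq_smul_of_isLocalMinOn_sphere hR hn hφ hmin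
  set x := c + R • n with hx
  set μ := fderiv ℝ φ x n with hμ
  have hμle : μ ≤ 0 := by
    -- The segment to the centre stays in the ball, so minimality gives a sign to the normal
    -- derivative.
    have hcone : -(R • n) ∈ posTangentConeAt (Metric.closedBall c R) x := by
      have := sub_mem_posTangentConeAt_of_segment_subset
        ((convex_closedBall c R).segment_subset hmem (Metric.mem_closedBall_self hR.le))
      rwa [hx, sub_add_cancel_left] at this
    have h := hminK.hasFDerivWithinAt_nonneg
      (hφ.differentiableAt (by simp)).hasFDerivAt.hasFDerivWithinAt hcone
    rw [map_neg, map_smul, smul_eq_mul, ← hμ] at h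
    by_contra! hpos
    nlinarith [mul_pos hR hpos]
  have hμne : μ ≠ 0 := fun h => hgrad (by rw [hgradn, h, zero_smul])
  have hμlt : μ < 0 := lt_of_le_of_ne hμle hμne
  have hunit : ‖∇ φ x‖⁻¹ • ∇ φ x = -n := by
    rw [hgradn, norm_smul, hn, mul_one, Real.norm_of_nonpos hμle, smul_smul, inv_neg, neg_mul,
      inv_mul_cancel₀ hμne, neg_one_smul]
  rw [levelSetOperator, hunit, iteratedFDeriv_two_diag, hgradn, inner_smul_right]
  simp only [map_neg, neg_apply, neg_neg]
  have h1 := mul_le_mul_of_nonneg_left hlap (hpos x).le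
  have h2 := mul_pos_of_neg_of_neg hμlt (hslope n hn)
  have h3 : a x * ((d - 1) * (μ / R)) = μ * (a x * ((d - 1) / R)) := by ring
  linarith

/-- A ball is a strict barrier for a medium which decreases fast enough across its boundary. -/
theorem isStrictBarrier_ball (hd : 1 ≤ d) (hR : 0 < R)
    {a : EuclideanSpace ℝ (Fin d) → ℝ} (ha : ContDiff ℝ 2 a) (hpos : ∀ x, 0 < a x)
    (hslope : ∀ n : EuclideanSpace ℝ (Fin d), ‖n‖ = 1 →
      a (c + R • n) * ((d - 1) / R) + inner ℝ (∇ a (c + R • n)) n < 0) :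
    IsStrictBarrier a (Metric.ball c R) where
  contDiff := ha
  isC2OpenSet := isC2OpenSet_ball hR
  isBounded := Metric.isBounded_ball
  nonempty := Metric.nonempty_ball.2 hR
  ne_univ := fun h => by
    have hmem : c + R • EuclideanSpace.single (⟨0, hd⟩ : Fin d) (1 : ℝ) ∈ Metric.ball c R :=
      h ▸ mem_univ _
    simp [norm_smul, abs_of_pos hR] at hmem
  classical := isClassicalStrictSubsolution_ball hd hR hpos hslope
  viscosity := isViscosityStrictSubsolution_ball hd hR hpos hslope

end Ball

/-- A compactly supported profile of slope `-1` at the origin. -/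
theorem exists_decreasing_profile : ∃ (θ : ℝ → ℝ) (B : ℝ), 0 < B ∧ ContDiff ℝ 2 θ ∧
    deriv θ 0 = -1 ∧ (∀ s, |θ s| ≤ B) ∧ (∀ s, |deriv θ s| ≤ B) ∧ ∀ s, 1 < |s| → θ s = 0 := by
  let β : ContDiffBump (0 : ℝ) := ⟨1 / 2, 1, by norm_num, by norm_num⟩
  have hC : ContDiff ℝ 2 (fun s => -s * β s) := contDiff_neg.mul β.contDiff
  have hsupp : HasCompactSupport (fun s => -s * β s) :=
    HasCompactSupport.mul_left β.hasCompactSupport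
  obtain ⟨B₁, hB₁⟩ := hsupp.exists_bound_of_continuous hC.continuous
  obtain ⟨B₂, hB₂⟩ := hsupp.deriv.exists_bound_of_continuous (hC.continuous_deriv (by norm_num))
  refine ⟨fun s => -s * β s, max 1 (max B₁ B₂), lt_of_lt_of_le one_pos (le_max_left _ _), hC, ?_,
    fun s => (hB₁ s).trans ((le_max_left _ _).trans (le_max_right _ _)),
    fun s => (hB₂ s).trans ((le_max_right _ _).trans (le_max_right _ _)), fun s hs => ?_⟩
  · have h : (fun s => -s * β s) =ᶠ[𝓝 0] fun s => -s := by
      filter_upwards [β.eventuallyEq_one] with s hs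
      rw [hs, Pi.one_apply, mul_one]
    rw [h.deriv_eq]
    simp
  · have : β s = 0 := β.zero_of_le_dist (by simpa [β] using hs.le)
    simp [this]

/-! ### Periodic extension from the unit cell -/

section Periodize

variable {d : ℕ}

/-- The lattice point below `x`. -/
noncomputable def latticeFloor (x : EuclideanSpace ℝ (Fin d)) : EuclideanSpace ℝ (Fin d) :=
  WithLp.toLp 2 (fun i => (⌊x i⌋ : ℝ))

/-- The `ℤ^d`-periodic function which agrees with `f` on the unit cell. -/
noncomputable def periodize (f : EuclideanSpace ℝ (Fin d) → ℝ) (x : EuclideanSpace ℝ (Fin d)) : ℝ :=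
  f (x - latticeFloor x)

theorem periodize_add_lattice (f : EuclideanSpace ℝ (Fin d) → ℝ) (k : Fin d → ℤ)
    (x : EuclideanSpace ℝ (Fin d)) :
    periodize f (x + WithLp.toLp 2 (fun i => (k i : ℝ))) = periodize f x := by
  unfold periodize
  congr 1
  ext i
  simp [latticeFloor]

theorem latticeFloor_of_mem_unitCell {x : EuclideanSpace ℝ (Fin d)} (hx : x ∈ unitCell d) :
    latticeFloor x = 0 := by
  ext i
  have : ⌊x i⌋ = 0 := Int.floor_eq_zero_iff.2 (hx i)
  simp [latticeFloor, this]

/-- Because `f` vanishes near the faces of the cell, the jumps of `latticeFloor` are invisible and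
smoothness is inherited from a translate of `f`. -/
theorem periodize_eventuallyEq {f : EuclideanSpace ℝ (Fin d) → ℝ}
    (hf : ∀ y : EuclideanSpace ℝ (Fin d), (∃ i, y i ∉ Icc (1 / 8 : ℝ) (7 / 8)) → f y = 0)
    (x : EuclideanSpace ℝ (Fin d)) :
    periodize f =ᶠ[𝓝 x] fun y => f (y - latticeFloor x) := by
  have hnear : ∀ᶠ y : EuclideanSpace ℝ (Fin d) in 𝓝 x,
      ∀ i, y i ∈ Ioo ((⌊x i⌋ : ℝ) - 1 / 8) (⌊x i⌋ + 1) := by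
    refine Filter.eventually_all.2 fun i => ?_
    have hc : ContinuousAt (fun y : EuclideanSpace ℝ (Fin d) => y i) x := by fun_prop
    refine hc.eventually (Ioo_mem_nhds ?_ (Int.lt_floor_add_one _))
    linarith [Int.floor_le (x i)]
  filter_upwards [hnear] with y hy
  by_cases h : ∀ i, (⌊x i⌋ : ℝ) ≤ y i
  · have : latticeFloor y = latticeFloor x := by
      ext i
      have : ⌊y i⌋ = ⌊x i⌋ := Int.floor_eq_iff.2 ⟨h i, (hy i).2⟩
      simp [latticeFloor, this]
    rw [periodize, this]
  -- Here `y` has crossed a face by less than `1/8`: its `i`-th coordinate exceeds `7/8` relative to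
  -- its own cell and is negative relative to that of `x`, so both values vanish.
  · push Not at h
    obtain ⟨i, hi⟩ := h
    have hfl : ⌊y i⌋ = ⌊x i⌋ - 1 := by
      rw [Int.floor_eq_iff]
      push_cast
      constructor <;> linarith [(hy i).1]
    rw [periodize, hf _ ⟨i, ?_⟩, hf _ ⟨i, ?_⟩]
    · rintro ⟨h1, -⟩
      simp only [latticeFloor, PiLp.sub_apply] at h1
      linarith
    · rintro ⟨-, h1⟩
      simp only [latticeFloor, PiLp.sub_apply, hfl] at h1
      push_cast at h1
      linarith [(hy i).1]

theorem contDiff_periodize {f : EuclideanSpace ℝ (Fin d) → ℝ} {n : WithTop ℕ∞}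
    (hf : ∀ y : EuclideanSpace ℝ (Fin d), (∃ i, y i ∉ Icc (1 / 8 : ℝ) (7 / 8)) → f y = 0)
    (hC : ContDiff ℝ n f) : ContDiff ℝ n (periodize f) :=
  contDiff_iff_contDiffAt.2 fun x =>
    (hC.comp (contDiff_id.sub contDiff_const)).contDiffAt.congr_of_eventuallyEq
      (periodize_eventuallyEq hf x)

theorem gradient_periodize_of_mem_unitCell {f : EuclideanSpace ℝ (Fin d) → ℝ}
    (hf : ∀ y : EuclideanSpace ℝ (Fin d), (∃ i, y i ∉ Icc (1 / 8 : ℝ) (7 / 8)) → f y = 0)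
    {x : EuclideanSpace ℝ (Fin d)} (hx : x ∈ unitCell d) : ∇ (periodize f) x = ∇ f x := by
  have h := periodize_eventuallyEq hf x
  simp only [latticeFloor_of_mem_unitCell hx, sub_zero] at h
  exact h.gradient_eq

end Periodize

/-! ### Measure and size of the unit cell -/

section UnitCell

variable {d : ℕ}

theorem volume_unitCell : volume (unitCell d) = 1 := by
  have h : unitCell d = WithLp.ofLp ⁻¹' (Set.univ.pi fun _ : Fin d => Ico (0 : ℝ) 1) := by
    ext x; simp [unitCell]
  rw [h, (PiLp.volume_preserving_ofLp (Fin d)).measure_preimage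
    (MeasurableSet.univ_pi fun _ => measurableSet_Ico).nullMeasurableSet, Real.volume_pi_Ico]
  simp

theorem measurableSet_unitCell : MeasurableSet (unitCell d) := by
  have h : unitCell d = ⋂ i, (fun x : EuclideanSpace ℝ (Fin d) => x i) ⁻¹' Ico (0 : ℝ) 1 := by
    ext x; simp [unitCell]
  rw [h]
  exact MeasurableSet.iInter fun i => measurableSet_Ico.preimage (by fun_prop)

theorem norm_le_of_mem_unitCell {x : EuclideanSpace ℝ (Fin d)} (hx : x ∈ unitCell d) :
    ‖x‖ ≤ d := by
  have h : ‖x‖ ^ 2 ≤ d := by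
    rw [EuclideanSpace.norm_sq_eq]
    calc ∑ i, ‖x i‖ ^ 2 ≤ ∑ _i : Fin d, (1 : ℝ) := Finset.sum_le_sum fun i _ => by
          rw [Real.norm_of_nonneg (hx i).1]
          exact pow_le_one₀ (hx i).1 (hx i).2.le
      _ = d := by simp
  have h2 : (d : ℝ) ≤ (d : ℝ) ^ 2 := by exact_mod_cast Nat.le_self_pow two_ne_zero d
  exact le_of_sq_le_sq (h.trans h2) (Nat.cast_nonneg d)

theorem eLpNorm_unitCell_le {F : Type*} [NormedAddCommGroup F] {f : EuclideanSpace ℝ (Fin d) → F}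
    {C : ℝ} (p : ENNReal) (h : ∀ x ∈ unitCell d, ‖f x‖ ≤ C) :
    eLpNorm f p (volume.restrict (unitCell d)) ≤ ENNReal.ofReal C := by
  have := eLpNorm_le_of_ae_bound (p := p)
    ((ae_restrict_iff' (μ := volume) measurableSet_unitCell).2 (Filter.Eventually.of_forall h))
  rwa [Measure.restrict_apply_univ, volume_unitCell, ENNReal.one_rpow, one_mul] at this

end UnitCell

/-! ### The steep perturbation in a thin shell -/

section Shell

variable {d : ℕ}

/-- The perturbation which has slope `-2 M ‖y - c‖` across the sphere of radius `R` and is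
supported in a shell of thickness of order `h`. -/
noncomputable def shellPerturbation (θ : ℝ → ℝ) (c : EuclideanSpace ℝ (Fin d)) (R M h : ℝ)
    (y : EuclideanSpace ℝ (Fin d)) : ℝ :=
  M * h * θ ((‖y - c‖ ^ 2 - R ^ 2) / h)

/-- The shell around the sphere of radius `R` which contains the support of the perturbation. -/
def shell (c : EuclideanSpace ℝ (Fin d)) (R h : ℝ) : Set (EuclideanSpace ℝ (Fin d)) :=
  {y | |‖y - c‖ ^ 2 - R ^ 2| ≤ h}

theorem isClosed_shell (c : EuclideanSpace ℝ (Fin d)) (R h : ℝ) : IsClosed (shell c R h) :=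
  isClosed_le (by fun_prop) continuous_const

variable {θ : ℝ → ℝ} {c : EuclideanSpace ℝ (Fin d)} {R M h : ℝ}

theorem contDiff_shellPerturbation (hθ : ContDiff ℝ 2 θ) :
    ContDiff ℝ 2 (shellPerturbation θ c R M h) :=
  contDiff_const.mul (hθ.comp
    ((((contDiff_id.sub contDiff_const).norm_sq ℝ).sub contDiff_const).div_const h))

theorem shellPerturbation_eq_zero (hh : 0 < h) (h0 : ∀ s, 1 < |s| → θ s = 0)
    {y : EuclideanSpace ℝ (Fin d)} (hy : y ∉ shell c R h) : shellPerturbation θ c R M h y = 0 := by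
  rw [shellPerturbation, h0, mul_zero]
  rw [abs_div, abs_of_pos hh, one_lt_div hh]
  exact not_le.1 hy

/-- The amplitude factor `h` cancels the `1 / h` of the chain rule, so the slope does not degrade as
the shell gets thin. -/
theorem inner_gradient_shellPerturbation (hh : 0 < h) (hθ : ContDiff ℝ 2 θ)
    (y v : EuclideanSpace ℝ (Fin d)) :
    inner ℝ (∇ (shellPerturbation θ c R M h) y) v =
      M * deriv θ ((‖y - c‖ ^ 2 - R ^ 2) / h) * (2 * inner ℝ (y - c) v) := by
  have h1 := ((((hasFDerivAt_id y).sub_const c).norm_sq).sub_const (R ^ 2)).mul_const h⁻¹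
  have h2 := ((hθ.differentiable (by simp)
    ((‖y - c‖ ^ 2 - R ^ 2) * h⁻¹)).hasDerivAt.comp_hasFDerivAt y h1).const_mul (M * h)
  rw [inner_gradient_left]
  have h3 : HasFDerivAt (shellPerturbation θ c R M h) _ y := h2
  rw [h3.fderiv, div_eq_mul_inv]
  simp only [id_eq, ContinuousLinearMap.comp_id, smul_apply, innerSL_apply_apply, smul_eq_mul,
    nsmul_eq_mul, Nat.cast_ofNat]
  field_simp

theorem norm_gradient_shellPerturbation_le (hh : 0 < h) (hM : 0 ≤ M) {B : ℝ}
    (hθ : ContDiff ℝ 2 θ) (hB : ∀ s, |deriv θ s| ≤ B) (h0 : ∀ s, 1 < |s| → θ s = 0)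
    (hR : R ^ 2 + h ≤ 1) (y : EuclideanSpace ℝ (Fin d)) :
    ‖∇ (shellPerturbation θ c R M h) y‖ ≤ (shell c R h).indicator (fun _ => 2 * M * B) y := by
  by_cases hy : y ∈ shell c R h
  · rw [indicator_of_mem hy]
    have hB0 : 0 ≤ B := (abs_nonneg _).trans (hB 0)
    have hy1 : ‖y - c‖ ≤ 1 := by
      have h1 : ‖y - c‖ ^ 2 ≤ 1 ^ 2 := by linarith [(abs_le.1 (show |_| ≤ h from hy)).2]
      exact le_of_sq_le_sq h1 zero_le_one
    set g := ∇ (shellPerturbation θ c R M h) y with hg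
    -- The gradient is paired with itself; `‖y - c‖ ≤ 1` on the shell.
    have h1 : ‖g‖ * ‖g‖ ≤ 2 * M * B * ‖g‖ := by
      rw [← real_inner_self_eq_norm_mul_norm]
      nth_rewrite 1 [hg]
      rw [inner_gradient_shellPerturbation hh hθ]
      calc M * deriv θ ((‖y - c‖ ^ 2 - R ^ 2) / h) * (2 * inner ℝ (y - c) g)
          ≤ |M * deriv θ ((‖y - c‖ ^ 2 - R ^ 2) / h) * (2 * inner ℝ (y - c) g)| := le_abs_self _
        _ = M * |deriv θ ((‖y - c‖ ^ 2 - R ^ 2) / h)| * (2 * |inner ℝ (y - c) g|) := by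
            rw [abs_mul, abs_mul, abs_mul, abs_of_nonneg hM, abs_two]
        _ ≤ M * B * (2 * (1 * ‖g‖)) := by
            gcongr
            · exact hB _
            · exact (abs_real_inner_le_norm _ _).trans (by gcongr)
        _ = 2 * M * B * ‖g‖ := by ring
    rcases (norm_nonneg g).eq_or_lt with h2 | h2
    · rw [← h2]; positivity
    · exact le_of_mul_le_mul_right h1 h2
  · rw [indicator_of_notMem hy]
    have : shellPerturbation θ c R M h =ᶠ[𝓝 y] fun _ => 0 := by
      filter_upwards [(isClosed_shell c R h).isOpen_compl.mem_nhds hy] with z hz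
      exact shellPerturbation_eq_zero hh h0 hz
    rw [this.gradient_eq, gradient_fun_const, norm_zero]

/-- Continuity from above: the shells decrease to the sphere, which is a null set. -/
theorem tendsto_volume_shell (hd : 1 ≤ d) (hR : 0 < R) (ν : Measure (EuclideanSpace ℝ (Fin d)))
    [IsFiniteMeasure ν] (hν : ν ≪ volume) :
    Filter.Tendsto (fun h => ν (shell c R h)) (𝓝[>] 0) (𝓝 0) := by
  have h1 := tendsto_measure_biInter_gt (μ := ν) (s := shell c R) (a := 0)
    (fun r _ => (isClosed_shell c R r).measurableSet.nullMeasurableSet)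
    (fun i j _ hij y hy => le_trans (show |_| ≤ i from hy) hij)
    ⟨1, one_pos, measure_ne_top _ _⟩
  have h2 : (⋂ r > 0, shell c R r) ⊆ Metric.sphere c R := fun y hy => by
    have h3 : |‖y - c‖ ^ 2 - R ^ 2| ≤ 0 :=
      le_of_forall_pos_le_add fun r hr => by
      rw [zero_add]; exact mem_iInter₂.1 hy r hr
    have h4 : ‖y - c‖ ^ 2 = R ^ 2 := sub_eq_zero.1 (abs_nonpos_iff.1 h3)
    rw [mem_sphere_iff_norm]
    exact (pow_left_inj₀ (norm_nonneg _) hR.le two_ne_zero).1 h4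
  have : Nonempty (Fin d) := ⟨⟨0, hd⟩⟩
  rwa [measure_mono_null h2 (hν (Measure.addHaar_sphere volume c R))] at h1

end Shell

/-! ### Mollification of continuous media -/

section Approximation

variable {d : ℕ} {Λ : ℝ} {a : EuclideanSpace ℝ (Fin d) → ℝ}

theorem sub_latticeFloor_mem_unitCell (x : EuclideanSpace ℝ (Fin d)) :
    x - latticeFloor x ∈ unitCell d := fun i =>
  ⟨Int.fract_nonneg (x i), Int.fract_lt_one (x i)⟩

theorem IsMedium.apply_sub_lattice (ha : IsMedium Λ a) (k : Fin d → ℤ)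
    (x : EuclideanSpace ℝ (Fin d)) : a (x - WithLp.toLp 2 (fun i => (k i : ℝ))) = a x := by
  rw [← ha.periodic k (x - WithLp.toLp 2 (fun i => (k i : ℝ))), sub_add_cancel]

theorem IsMedium.uniform_modulus (ha : IsMedium Λ a) {ε : ℝ} (hε : 0 < ε) :
    ∃ ρ > 0, ∀ x, ∀ y ∈ Metric.ball x ρ, dist (a y) (a x) ≤ ε := by
  -- Only one of the two points has to lie in the compact set, so a single lattice translation,
  -- bringing `x` into the cell, suffices.
  have h := (isCompact_closedBall (0 : EuclideanSpace ℝ (Fin d))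
    d).uniformContinuousAt_of_continuousAt a (fun x _ => ha.continuous.continuousAt) (Metric.dist_mem_uniformity hε)
  obtain ⟨ρ, hρ, hball⟩ := Metric.mem_uniformity_dist.1 h
  refine ⟨ρ, hρ, fun x y hy => ?_⟩
  have h1 : x - latticeFloor x ∈ Metric.closedBall (0 : EuclideanSpace ℝ (Fin d)) d := by
    rw [mem_closedBall_zero_iff]
    exact norm_le_of_mem_unitCell (sub_latticeFloor_mem_unitCell x)
  have h2 : dist (x - latticeFloor x) (y - latticeFloor x) < ρ := by
    rw [dist_sub_right, dist_comm]; exact hy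
  have h3 : dist (a (x - latticeFloor x)) (a (y - latticeFloor x)) < ε := hball h2 h1
  rw [latticeFloor, ha.apply_sub_lattice, ha.apply_sub_lattice, dist_comm] at h3
  exact h3.le

theorem IsMedium.exists_contDiff_approx (ha : IsMedium Λ a) {ε : ℝ} (hε : 0 < ε) :
    ∃ b : EuclideanSpace ℝ (Fin d) → ℝ, IsMedium Λ b ∧ ContDiff ℝ 2 b ∧ ∀ x, |a x - b x| ≤ ε := by
  obtain ⟨ρ, hρ, hmod⟩ := ha.uniform_modulus hε
  let β : ContDiffBump (0 : EuclideanSpace ℝ (Fin d)) := ⟨ρ / 2, ρ, half_pos hρ, half_lt_self hρ⟩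
  let b : EuclideanSpace ℝ (Fin d) → ℝ :=
    convolution (β.normed volume) a (ContinuousLinearMap.lsmul ℝ ℝ) volume
  have hC : ContDiff ℝ 2 b := β.hasCompactSupport_normed.contDiff_convolution_left (n := 2) _
    β.contDiff_normed ha.continuous.locallyIntegrable
  refine ⟨b, ⟨hC.continuous, fun k x => ?_, fun x => ?_⟩, hC, fun x => ?_⟩
  · simp only [b, convolution_lsmul]
    congr 1
    ext t
    rw [add_sub_right_comm, ha.periodic]
  -- The interval `[1, Λ]` is a ball about its midpoint, and averages stay in it.
  · have h := dist_convolution_le (μ := volume) (x₀ := x) (z₀ := (1 + Λ) / 2) (ε := (Λ - 1) / 2)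
      (by have := ha.mem_Icc x; linarith [this.1.trans this.2])
      β.support_normed_eq.subset β.nonneg_normed β.integral_normed
      ha.continuous.aestronglyMeasurable (fun y _ => by
        rw [Real.dist_eq, abs_le]
        constructor <;> linarith [(ha.mem_Icc y).1, (ha.mem_Icc y).2])
    rw [Real.dist_eq, abs_le] at h
    constructor <;> linarith [h.1, h.2]
  · have h := β.dist_normed_convolution_le (μ := volume) (x₀ := x)
      ha.continuous.aestronglyMeasurable (hmod x)
    rwa [Real.dist_eq, abs_sub_comm] at h

end Approximation

/-! ### Construction of the perturbed medium -/

section Construction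

variable {d : ℕ}

theorem continuous_gradient {f : EuclideanSpace ℝ (Fin d) → ℝ} (hf : ContDiff ℝ 2 f) :
    Continuous (∇ f) :=
  (InnerProductSpace.toDual ℝ _).symm.continuous.comp (hf.continuous_fderiv (by simp))

/-- The center of the unit cell. -/
noncomputable def cellCenter (d : ℕ) : EuclideanSpace ℝ (Fin d) :=
  WithLp.toLp 2 (fun _ => 1 / 2)

theorem abs_sub_half_le (x : EuclideanSpace ℝ (Fin d)) (i : Fin d) :
    |x i - 1 / 2| ≤ ‖x - cellCenter d‖ :=
  PiLp.norm_apply_le (x - cellCenter d) i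

theorem mem_unitCell_of_dist_center {x : EuclideanSpace ℝ (Fin d)}
    (hx : ‖x - cellCenter d‖ ≤ 1 / 4) : x ∈ unitCell d := fun i => by
  have := abs_le.1 ((abs_sub_half_le x i).trans hx)
  constructor <;> linarith [this.1, this.2]

theorem shellPerturbation_center_eq_zero {θ : ℝ → ℝ} {M h : ℝ} (hh : 0 < h) (hh' : h ≤ 1 / 16)
    (h0 : ∀ s, 1 < |s| → θ s = 0) (y : EuclideanSpace ℝ (Fin d))
    (hy : ∃ i, y i ∉ Icc (1 / 8 : ℝ) (7 / 8)) :
    shellPerturbation θ (cellCenter d) (1 / 4) M h y = 0 := by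
  obtain ⟨i, hi⟩ := hy
  refine shellPerturbation_eq_zero hh h0 fun hmem => hi ?_
  have h1 : |‖y - cellCenter d‖ ^ 2 - (1 / 4) ^ 2| ≤ h := hmem
  -- Indeed `1/16 + h ≤ 1/8 ≤ (3/8)²`, and `1/2 ± 3/8` are the bounds `1/8` and `7/8`.
  have h2 : ‖y - cellCenter d‖ ≤ 3 / 8 := by
    refine le_of_sq_le_sq ?_ (by norm_num)
    linarith [(abs_le.1 h1).2]
  have h3 := abs_le.1 ((abs_sub_half_le y i).trans h2)
  constructor <;> linarith [h3.1, h3.2]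

theorem eLpNorm_indicator_shell_le {h C : ℝ} {p : ℝ} (hp : 1 ≤ p) (c : EuclideanSpace ℝ (Fin d))
    (R : ℝ) (μ : Measure (EuclideanSpace ℝ (Fin d))) (hC : 0 ≤ C) :
    eLpNorm ((shell c R h).indicator fun _ => C) (ENNReal.ofReal p) μ ≤
      ENNReal.ofReal C * μ (shell c R h) ^ (1 / p) := by
  refine (eLpNorm_indicator_const_le C (ENNReal.ofReal p)).trans ?_
  rw [ENNReal.toReal_ofReal (by linarith), Real.enorm_of_nonneg hC]

/-- A medium of class `C²` has a strict barrier after a perturbation which is small in the uniform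
norm and in `W^{1,p}`. -/
theorem IsMedium.exists_strictBarrier (hd : 1 ≤ d) {Λ : ℝ} (hΛ : 1 < Λ)
    {a : EuclideanSpace ℝ (Fin d) → ℝ} (ha : IsMedium Λ a) (haC : ContDiff ℝ 2 a) {δ : ℝ}
    (hδ : 0 < δ) {p : ℝ} (hp : 1 ≤ p) :
    ∃ (b : EuclideanSpace ℝ (Fin d) → ℝ) (Ω : Set (EuclideanSpace ℝ (Fin d))),
      IsMedium Λ b ∧ (∀ x, |a x - b x| ≤ δ) ∧
        torusSobolevNorm p (fun x => a x - b x) ≤ ENNReal.ofReal δ ∧ IsStrictBarrier b Ω := by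
  obtain ⟨θ, B, hB, hθ, hθ0, hθB, hθB', hθs⟩ := exists_decreasing_profile
  set c := cellCenter d with hc
  have hd' : (1 : ℝ) ≤ d := by exact_mod_cast hd
  -- Bounds for the gradient of `a` on the unit cell.
  obtain ⟨G₀, hG₀⟩ := (isCompact_closedBall (0 : EuclideanSpace ℝ (Fin d))
    d).exists_bound_of_continuousOn (continuous_gradient haC).continuousOn
  set G := max G₀ 0
  have hG0 : 0 ≤ G := le_max_right _ _
  have hG : ∀ x ∈ unitCell d, ‖∇ a x‖ ≤ G := fun x hx =>
    (hG₀ x (mem_closedBall_zero_iff.2 (norm_le_of_mem_unitCell hx))).trans (le_max_left _ _)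
  -- The contraction towards the middle of `[1, Λ]`.
  set m := (1 + Λ) / 2 with hm
  -- The contraction is cheap in value and in gradient, yet leaves the margin `t (Λ - 1) / 2` at
  -- both ends of `[1, Λ]`.
  set t := min (1 / 2) (δ / (8 * (Λ + G))) with ht
  have hΛG : 0 < Λ + G := by linarith
  have ht0 : 0 < t := lt_min (by norm_num) (by positivity)
  have ht1 : t ≤ 1 / 2 := min_le_left _ _
  have htδ : t * (Λ + G) ≤ δ / 8 := by
    have h1 : t * (Λ + G) ≤ δ / (8 * (Λ + G)) * (Λ + G) := by
      gcongr
      exact min_le_right _ _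
    refine h1.trans (le_of_eq ?_)
    field_simp
  have htΛ : t * (Λ - 1) ≤ δ / 8 := by nlinarith
  have htG : t * G ≤ δ / 8 := by nlinarith
  -- The slope and the thickness of the perturbation.
  set M := 2 * (4 * Λ * d + G + 1) with hM
  have hM0 : 0 < M := by positivity
  have hlim : Filter.Tendsto (fun h => ENNReal.ofReal (2 * M * B) *
      (volume.restrict (unitCell d)) (shell c (1 / 4) h) ^ (1 / p)) (𝓝[>] 0) (𝓝 0) := by
    have : IsFiniteMeasure (volume.restrict (unitCell d)) :=
      ⟨by rw [Measure.restrict_apply_univ, volume_unitCell]; exact ENNReal.one_lt_top⟩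
    have h1 := tendsto_volume_shell (c := c) (R := 1 / 4) hd (by norm_num)
      (volume.restrict (unitCell d)) Measure.restrict_le_self.absolutelyContinuous
    have h2 := (ENNReal.continuous_rpow_const (y := 1 / p)).continuousAt.tendsto.comp h1
    have h3 := ENNReal.Tendsto.const_mul (a := ENNReal.ofReal (2 * M * B)) h2
      (Or.inr ENNReal.ofReal_ne_top)
    rwa [ENNReal.zero_rpow_of_pos (by positivity), mul_zero] at h3
  obtain ⟨h, hh0, hh1, hhB, hhν⟩ : ∃ h : ℝ, 0 < h ∧ h ≤ 1 / 16 ∧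
      M * h * B ≤ min (t * (Λ - 1) / 2) (δ / 4) ∧
      ENNReal.ofReal (2 * M * B) *
        (volume.restrict (unitCell d)) (shell c (1 / 4) h) ^ (1 / p) ≤ ENNReal.ofReal (δ / 4) := by
    have e1 : ∀ᶠ h : ℝ in 𝓝[>] 0, h ≤ 1 / 16 :=
      Filter.Eventually.filter_mono nhdsWithin_le_nhds (Iic_mem_nhds (by norm_num))
    have e2 : ∀ᶠ h : ℝ in 𝓝[>] 0, M * h * B ≤ min (t * (Λ - 1) / 2) (δ / 4) := by
      have hcont : ContinuousAt (fun h : ℝ => M * h * B) 0 := by fun_prop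
      refine Filter.Eventually.filter_mono nhdsWithin_le_nhds
        (hcont.eventually (Iic_mem_nhds ?_))
      have : 0 < t * (Λ - 1) := mul_pos ht0 (by linarith)
      simp only [mul_zero, zero_mul]
      exact lt_min (by positivity) (by positivity)
    have e3 := hlim.eventually (Iic_mem_nhds (ENNReal.ofReal_pos.2 (show 0 < δ / 4 by positivity)))
    have e0 : ∀ᶠ h : ℝ in 𝓝[>] 0, 0 < h := self_mem_nhdsWithin
    obtain ⟨h, h1, h2, h3, h4⟩ := (e0.and (e1.and (e2.and e3))).exists
    exact ⟨h, h1, h2, h3, h4⟩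
  set f := shellPerturbation θ c (1 / 4) M h with hf
  have hfC : ContDiff ℝ 2 f := contDiff_shellPerturbation hθ
  have hfs := shellPerturbation_center_eq_zero (d := d) (M := M) hh0 hh1 hθs
  set F := periodize f with hF
  have hFC : ContDiff ℝ 2 F := contDiff_periodize hfs hfC
  have hFle : ∀ x, |F x| ≤ M * h * B := fun x => by
    rw [hF, periodize, hf, shellPerturbation, abs_mul, abs_of_pos (mul_pos hM0 hh0)]
    exact mul_le_mul_of_nonneg_left (hθB _) (mul_pos hM0 hh0).le
  have hFle1 : ∀ x, |F x| ≤ t * (Λ - 1) / 2 := fun x =>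
    (hFle x).trans (hhB.trans (min_le_left _ _))
  have hFle2 : ∀ x, |F x| ≤ δ / 4 := fun x => (hFle x).trans (hhB.trans (min_le_right _ _))
  have hFgrad : ∀ x ∈ unitCell d, ∇ F x = ∇ f x := fun x hx =>
    gradient_periodize_of_mem_unitCell hfs hx
  have hagrad : ∀ x, HasFDerivAt a (fderiv ℝ a x) x := fun x =>
    (haC.differentiable (by simp) x).hasFDerivAt
  have hFgrad' : ∀ x, HasFDerivAt F (fderiv ℝ F x) x := fun x =>
    (hFC.differentiable (by simp) x).hasFDerivAt
  have ham : ∀ x, |a x - m| ≤ (Λ - 1) / 2 := fun x => by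
    rw [abs_le]
    constructor <;> linarith [(ha.mem_Icc x).1, (ha.mem_Icc x).2]
  set b : EuclideanSpace ℝ (Fin d) → ℝ := fun x => a x + t * (m - a x) + F x with hb
  have hbC : ContDiff ℝ 2 b := (haC.add (contDiff_const.mul (contDiff_const.sub haC))).add hFC
  have hbm : IsMedium Λ b := by
    refine ⟨hbC.continuous, fun k x => ?_, fun x => ?_⟩
    · simp only [hb, hF, ha.periodic, periodize_add_lattice]
    · have h1 := abs_le.1 (ham x)
      have h2 := abs_le.1 (hFle1 x)
      have h3 : b x - m = (1 - t) * (a x - m) + F x := by simp only [hb]; ring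
      have h4 : (1 - t) * (a x - m) ≤ (1 - t) * ((Λ - 1) / 2) :=
        mul_le_mul_of_nonneg_left h1.2 (by linarith)
      have h5 : (1 - t) * (-((Λ - 1) / 2)) ≤ (1 - t) * (a x - m) :=
        mul_le_mul_of_nonneg_left h1.1 (by linarith)
      constructor <;> linarith [h2.1, h2.2]
  have hdiff : ∀ x, a x - b x = t * (a x - m) - F x := fun x => by simp only [hb]; ring
  have hsup : ∀ x, |a x - b x| ≤ δ / 2 := fun x => by
    rw [hdiff]
    have h1 : |t * (a x - m)| ≤ t * ((Λ - 1) / 2) := by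
      rw [abs_mul, abs_of_pos ht0]
      exact mul_le_mul_of_nonneg_left (ham x) ht0.le
    linarith [abs_sub (t * (a x - m)) (F x), hFle2 x]
  refine ⟨b, Metric.ball c (1 / 4), hbm, fun x => (hsup x).trans (by linarith), ?_, ?_⟩
  · have hgrad : (fun x => ∇ (fun x => a x - b x) x) = (fun x => t • ∇ a x) - ∇ F := by
      funext x
      have h1 : HasFDerivAt (fun x => a x - b x) (t • fderiv ℝ a x - fderiv ℝ F x) x := by
        simp only [hdiff]
        exact (((hagrad x).sub_const m).const_mul t).sub (hFgrad' x)
      rw [Pi.sub_apply, gradient, h1.fderiv, map_sub, LinearIsometryEquiv.map_smul]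
      rfl
    have hA : eLpNorm (fun x => t • ∇ a x) (ENNReal.ofReal p) (volume.restrict (unitCell d)) ≤
        ENNReal.ofReal (δ / 8) := eLpNorm_unitCell_le _ fun x hx => by
      rw [norm_smul, Real.norm_of_nonneg ht0.le]
      exact (mul_le_mul_of_nonneg_left (hG x hx) ht0.le).trans htG
    have hFn : eLpNorm (∇ F) (ENNReal.ofReal p) (volume.restrict (unitCell d)) ≤
        ENNReal.ofReal (δ / 4) := by
      refine le_trans ?_ hhν
      refine le_trans ?_ (eLpNorm_indicator_shell_le hp c (1 / 4) _ (by positivity))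
      refine eLpNorm_mono_ae_real ?_
      refine (ae_restrict_iff' measurableSet_unitCell).2 (Filter.Eventually.of_forall fun x hx => ?_)
      rw [hFgrad x hx]
      exact norm_gradient_shellPerturbation_le hh0 hM0.le hθ hθB' hθs (by linarith) x
    have h1 : eLpNorm (fun x => a x - b x) (ENNReal.ofReal p) (volume.restrict (unitCell d)) ≤
        ENNReal.ofReal (δ / 2) := eLpNorm_unitCell_le _ fun x _ => hsup x
    rw [torusSobolevNorm, hgrad]
    have h2 := eLpNorm_sub_le (μ := volume.restrict (unitCell d)) (p := ENNReal.ofReal p)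
      ((continuous_gradient haC).const_smul t).aestronglyMeasurable
      (continuous_gradient hFC).aestronglyMeasurable (by simpa using hp)
    -- The total is `δ/2 + δ/8 + δ/4 ≤ δ`.
    refine (add_le_add h1 (h2.trans (add_le_add hA hFn))).trans ?_
    rw [← ENNReal.ofReal_add (by positivity) (by positivity),
      ← ENNReal.ofReal_add (by positivity) (by positivity)]
    exact ENNReal.ofReal_le_ofReal (by linarith)
  · refine isStrictBarrier_ball hd (by norm_num) hbC
      (fun x => one_pos.trans_le (hbm.mem_Icc x).1) fun n hn => ?_
    set x := c + (1 / 4 : ℝ) • n with hx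
    have hxc : x - c = (1 / 4 : ℝ) • n := by rw [hx, add_sub_cancel_left]
    have hxn : ‖x - c‖ = 1 / 4 := by rw [hxc, norm_smul, hn]; norm_num
    have hcell : x ∈ unitCell d := mem_unitCell_of_dist_center hxn.le
    have h1 : HasFDerivAt b (fderiv ℝ a x + t • (-fderiv ℝ a x) + fderiv ℝ F x) x :=
      ((hagrad x).add (((hagrad x).const_sub m).const_mul t)).add (hFgrad' x)
    have h2 : inner ℝ (∇ F x) n = -(M / 2) := by
      rw [hFgrad x hcell, inner_gradient_shellPerturbation hh0 hθ, hxn, sub_self, zero_div, hθ0,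
        hxc, inner_smul_left, real_inner_self_eq_norm_sq, hn]
      simp
      ring
    have h3 : inner ℝ (∇ a x) n ≤ G := by
      refine (real_inner_le_norm _ _).trans ?_
      rw [hn, mul_one]
      exact hG x hcell
    have h4 : inner ℝ (∇ b x) n = (1 - t) * inner ℝ (∇ a x) n + inner ℝ (∇ F x) n := by
      rw [inner_gradient_left, inner_gradient_left, inner_gradient_left, h1.fderiv]
      simp only [add_apply, smul_apply, neg_apply, smul_eq_mul]
      ring
    have h5 : (1 - t) * inner ℝ (∇ a x) n ≤ G :=
      (mul_le_mul_of_nonneg_left h3 (by linarith)).trans (by nlinarith)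
    have h6 : b x * ((d - 1) / (1 / 4)) ≤ 4 * Λ * d := by
      have := mul_le_mul_of_nonneg_right (hbm.mem_Icc x).2 (show (0 : ℝ) ≤ (d - 1) / (1 / 4) by
        apply div_nonneg <;> linarith)
      refine this.trans ?_
      rw [show Λ * ((d - 1) / (1 / 4)) = 4 * Λ * d - 4 * Λ by ring]
      linarith
    rw [h4, h2]
    linarith

end Construction

theorem lemma4p4 {d : ℕ} (hd : 1 ≤ d) {Λ : ℝ} (hΛ : 1 < Λ)
    (a : EuclideanSpace ℝ (Fin d) → ℝ) (ha : IsMedium Λ a) (δ : ℝ) (hδ : 0 < δ) :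
    (∃ (aδ : EuclideanSpace ℝ (Fin d) → ℝ) (Ω : Set (EuclideanSpace ℝ (Fin d))),
      IsMedium Λ aδ ∧ (∀ x, |a x - aδ x| ≤ δ) ∧ IsStrictBarrier aδ Ω) ∧
    (ContDiff ℝ 2 a → ∀ p : ℝ, 1 ≤ p →
      ∃ (aδ : EuclideanSpace ℝ (Fin d) → ℝ) (Ω : Set (EuclideanSpace ℝ (Fin d))),
        IsMedium Λ aδ ∧ (∀ x, |a x - aδ x| ≤ δ) ∧
          torusSobolevNorm p (fun x => a x - aδ x) ≤ ENNReal.ofReal δ ∧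
          IsStrictBarrier aδ Ω) := by
  refine ⟨?_, fun haC p hp => ha.exists_strictBarrier hd hΛ haC hδ hp⟩
  obtain ⟨b, hb, hbC, hab⟩ := ha.exists_contDiff_approx (half_pos hδ)
  -- The Sobolev bound is discarded, so any exponent would do; `le_rfl` selects `p = 1`.
  obtain ⟨aδ, Ω, hm, hclose, -, hbar⟩ :=
    hb.exists_strictBarrier hd hΛ hbC (half_pos hδ) le_rfl
  refine ⟨aδ, Ω, hm, fun x => ?_, hbar⟩
  linarith [abs_sub_le (a x) (b x) (aδ x), hab x, hclose x]
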